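/- Write $\omega=\{0,1,2,\dots\}$, let ${}^{<\omega}\omega$ be the set of finite sequences in $\omega$, and let the Baire space be ${}^\omega\omega$ with the product topology of discrete copies of $\omega$. A tree is a strict partial order in which the set of predecessors of every node is well-ordered; a branch is an inclusion-maximal chain; a son of $x$ is an immediate successor of $x$. A foliage tree $\mathbf F$ is a tree together with a set $\mathbf F_x$ (the leaf at $x$) for each node $x$. A foliage tree $\mathbf F$ is a $\pi$-tree on a topological space $X$ if: (i) its underlying tree is isomorphic to $({}^{<\omega}\omega,\subset)$, every leaf is an open subset of $X$, and the leaf at the least node is $X$; (ii) for each node $x$, $\mathbf F_x$ is the union of the pairwise disjoint leaves at the sons of $x$; (iii) for every branch $B$ the set $\bigcap_{x\in B}\mathbf F_x$ is a singleton; (iv) for every $p\in X$ and every neighbourhood $V$ of $p$ there are a node $z$ with $p\in\mathbf F_z$ and a cofinite subset $C$ of the set of sons of $z$ such that $\varnothing\neq\bigcup_{s\in C}\mathbf F_s\subseteq V$. The standard foliage tree $\mathbf S$ has underlying tree $({}^{<\omega}\omega,\subset)$ and leaves $\mathbf S_x=\{p\in{}^\omega\omega : x\subseteq p\}$. A set $A\subseteq{}^\omega\omega$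 is $\pi$-dense in the Baire space if for every $y\in{}^{<\omega}\omega$ the set $\{n\in\omega : \mathbf S_{y^\frown\langle n\rangle}\subseteq A\}$ is infinite. **Theorem.** Let $Y=\bigcap_{n\in\omega}U_n$, where each $U_n$ is an open $\pi$-dense subset of the Baire space. Then there is a foliage tree $\mathbf H$ such that, for every topology $\tau$ on ${}^\omega\omega$ for which $\mathbf S$ is a $\pi$-tree on $({}^\omega\omega,\tau)$, $\mathbf H$ is a $\pi$-tree on $Y$ considered as a subspace of $({}^\omega\omega,\tau)$. In particular, $Y$ as a subspace of $({}^\omega\omega,\tau)$ has a $\pi$-tree for every such $\tau$. -/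

import Mathlib

universe u v

/-- A (set-theoretic) tree: a strict partially ordered set in which the set of predecessors of
every node is well-ordered. -/
structure SetTree where
  /-- the nodes of the tree -/
  Node : Type u
  /-- the strict order `x < y` on the nodes -/
  lt : Node → Node → Prop
  irrefl : ∀ x, ¬ lt x x
  trans : ∀ x y z, lt x y → lt y z → lt x z
  wellOrdered : ∀ x, IsWellOrder {v : Node // lt v x} (fun a b => lt a.1 b.1)

namespace SetTree

variable (T : SetTree.{u})

/-- `IsSon x s`: `s` is an immediate successor of `x`. -/
def IsSon (x s : T.Node) : Prop :=
  T.lt x s ∧ ¬ ∃ v, T.lt x v ∧ T.lt v s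

/-- The set of sons (immediate successors) of `x`. -/
def sons (x : T.Node) : Set T.Node := {s | T.IsSon x s}

/-- The set of maximal nodes. -/
def maxNodes : Set T.Node := {m | ∀ v, ¬ T.lt m v}

/-- `r` is the least node. -/
def IsLeastNode (r : T.Node) : Prop := ∀ v, v = r ∨ T.lt r v

/-- A branch is an inclusion-maximal chain. -/
def IsBranch (B : Set T.Node) : Prop := IsMaxChain T.lt B

/-- The tree of finite sequences of natural numbers, ordered by proper extension. -/
def finSeq : SetTree.{0} where
  Node := List ℕ
  lt s t := s <+: t ∧ s ≠ t
  irrefl _ h := h.2 rfl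
  trans x y z hxy hyz := by
    refine ⟨hxy.1.trans hyz.1, ?_⟩
    rintro rfl
    exact hxy.2 (hxy.1.eq_of_length_le hyz.1.length_le)
  wellOrdered x :=
    { trichotomous := by
        rintro ⟨a, ha⟩ ⟨b, hb⟩ h1 h2
        by_contra hne
        have hne' : a ≠ b := fun h => hne (Subtype.ext h)
        rcases List.prefix_or_prefix_of_prefix ha.1 hb.1 with h | h
        · exact h1 ⟨h, hne'⟩
        · exact h2 ⟨h, hne'.symm⟩
      wf := by
        refine Subrelation.wf (r := InvImage (· < ·)
          (fun a : {v : List ℕ // v <+: x ∧ v ≠ x} => a.1.length)) ?_ (InvImage.wf _ wellFounded_lt)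
        rintro ⟨a, ha⟩ ⟨b, hb⟩ h
        rcases lt_or_ge a.length b.length with hl | hl
        · exact hl
        · exact absurd (h.1.eq_of_length_le hl) h.2 }

/-- An `ω, ℵ₀`-tree: a tree isomorphic to the tree of finite sequences of natural numbers. -/
def IsOmegaAlephNullTree : Prop := Nonempty (T.lt ≃r finSeq.lt)

end SetTree

/-- A foliage tree with leaves in `X`: a tree together with a set (leaf) `leaf x ⊆ X` at each
node `x`. -/
structure FoliageTree (X : Type v) extends SetTree.{u} where
  /-- the leaf at a node -/
  leaf : Node → Set X

namespace FoliageTree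

variable {X : Type v} (F : FoliageTree.{u, v} X)

/-- The intersection of the leaves at the nodes in `A`. -/
def fruit (A : Set F.Node) : Set X := ⋂ x ∈ A, F.leaf x

/-- The union of the leaves at the nodes in `A`. -/
def flesh (A : Set F.Node) : Set X := ⋃ x ∈ A, F.leaf x

/-- The family of the sets `flesh C` for the cofinite subsets `C` of the set of sons of `z`. -/
def shoot (z : F.Node) : Set (Set X) :=
  {A | ∃ C : Set F.Node, C ⊆ F.sons z ∧ (F.sons z \ C).Finite ∧ A = F.flesh C}

/-- The set of nodes whose leaf contains `p`. -/
def scope (p : X) : Set F.Node := {y | p ∈ F.leaf y}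

/-- The set of nodes is nonempty and the fruit of every branch is a singleton. -/
def HasStrictBranches : Prop :=
  Nonempty F.Node ∧ ∀ B : Set F.Node, F.IsBranch B → ∃ p, F.fruit B = {p}

/-- The leaf at each non-maximal node is the disjoint union of the leaves at its sons. -/
def IsLocallyStrict : Prop :=
  ∀ x, x ∉ F.maxNodes →
    F.leaf x = (⋃ s ∈ F.sons x, F.leaf s) ∧ (F.sons x).PairwiseDisjoint F.leaf

/-- All leaves are open in the space `(X, τ)`. -/
def IsOpenIn (τ : TopologicalSpace X) : Prop := ∀ z, @IsOpen X τ (F.leaf z)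

/-- `F` is a Baire foliage tree on the space `(X, τ)`. -/
structure IsBaireOn (τ : TopologicalSpace X) : Prop where
  isOpenIn : F.IsOpenIn τ
  isLocallyStrict : F.IsLocallyStrict
  isOmegaAlephNullTree : F.IsOmegaAlephNullTree
  hasStrictBranches : F.HasStrictBranches
  leaf_least : ∃ r, F.IsLeastNode r ∧ F.leaf r = Set.univ

end FoliageTree

/-- The family `γ` `π`-refines the family `δ`: every nonempty member of `δ` contains a nonempty
member of `γ`. -/
def PiRefines {X : Type v} (γ δ : Set (Set X)) : Prop :=
  ∀ D ∈ δ \ {∅}, ∃ G ∈ γ \ {∅}, G ⊆ D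

namespace FoliageTree

variable {X : Type v} (F : FoliageTree.{u, v} X)

/-- `F` grows into the space `(X, τ)`. -/
def GrowsInto (τ : TopologicalSpace X) : Prop :=
  ∀ p : X, ∀ U ∈ @nhds X τ p, ∃ z ∈ F.scope p, PiRefines (F.shoot z) {U}

/-- `F` is a `π`-tree on the space `(X, τ)`. -/
def IsPiTreeOn (τ : TopologicalSpace X) : Prop := F.IsBaireOn τ ∧ F.GrowsInto τ

/-- The standard foliage tree of `ℕ → ℕ`: its skeleton is the tree of finite sequences of natural
numbers and its leaf at `x` is the set of all `p : ℕ → ℕ` that extend `x`. -/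
def standard : FoliageTree.{0, 0} (ℕ → ℕ) where
  toSetTree := SetTree.finSeq
  leaf x := {p | ∀ (i : ℕ) (h : i < List.length x), p i = List.get x ⟨i, h⟩}

end FoliageTree

/-- `A` is `π`-dense in the Baire space: for every finite sequence `y`, the leaf of the standard
foliage tree at `y⌢⟨n⟩` is contained in `A` for infinitely many `n`. -/
def IsPiDense (A : Set (ℕ → ℕ)) : Prop :=
  ∀ y : List ℕ, {n : ℕ | FoliageTree.standard.leaf (y ++ [n] : List ℕ) ⊆ A}.Infinite

/-! Call a son of a word `z` good if passing to it raises the number of sets `U i` known to contain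
the whole cylinder (`level`, `levelUp`). By π-density every word has infinitely many good sons, and
by openness `Y` consists exactly of the sequences that pass to a good son infinitely often
(`mem_iInter_iff_goodInfinitelyOften`). Only this combinatorial description of `Y` is used to build
the tree.

The tree of single words fails because a branch may make only bad choices from some point on and
then contains no point of `Y`. Instead, each leaf is a union of cylinders in which a bad word always
accompanies good ones. The good sons of each word are cut into infinitely many infinite classes, and
each class receives at most one bad son. A `main` state carries a main word and perhaps a secondary
one. Each new main word is a good son. While some secondary word is kept, the main word moves to a
good son of its own and the new secondary word is a bad son; a good son of the secondary word is
split off as a main word alone. Along a branch some limit meets the main words infinitely often,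
hence lies in `Y`; of two distinct limits, one would eventually be secondary forever and make only
bad choices. So each branch has exactly one point of `Y` (`existsUnique_mem_leaf`).

For growth, every initial segment `z` of `p` is handled at a split state around `p`: all its sons
but one are cylinders at distinct sons of `z` (`exists_handles`). A neighbourhood of `p` contains a
tail of the sons of some such `z`. The construction never refers to `τ`, so one tree serves all
topologies. -/

/-! ### Initial segments of infinite sequences -/

/-- The initial segment of length `k` of an infinite sequence. -/
def initSeg (p : ℕ → ℕ) (k : ℕ) : List ℕ := (List.range k).map p

@[simp] theorem initSeg_length (p : ℕ → ℕ) (k : ℕ) : (initSeg p k).length = k := by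
  simp [initSeg]

theorem initSeg_succ (p : ℕ → ℕ) (k : ℕ) : initSeg p (k + 1) = initSeg p k ++ [p k] := by
  simp [initSeg, List.range_succ]

theorem initSeg_take (p : ℕ → ℕ) {k l : ℕ} (h : k ≤ l) :
    (initSeg p l).take k = initSeg p k := by
  simp [initSeg, ← List.map_take, List.take_range, h]

theorem initSeg_prefix (p : ℕ → ℕ) {k l : ℕ} (h : k ≤ l) : initSeg p k <+: initSeg p l := by
  rw [← initSeg_take p h]
  exact List.take_prefix _ _

theorem initSeg_succ_eq_append {p : ℕ → ℕ} {k : ℕ} {u : List ℕ} {m : ℕ} :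
    initSeg p (k + 1) = u ++ [m] ↔ initSeg p k = u ∧ p k = m := by
  rw [initSeg_succ]
  simp

theorem mem_standard_leaf {p : ℕ → ℕ} {z : List ℕ} :
    p ∈ FoliageTree.standard.leaf z ↔ initSeg p z.length = z := by
  change (∀ (i : ℕ) (h : i < z.length), p i = z.get ⟨i, h⟩) ↔ _
  constructor
  · intro h
    apply List.ext_get (by simp)
    intro n h1 h2
    simp [initSeg, h n h2]
  · intro h i hi
    have : (initSeg p z.length)[i]'(by simpa using hi) = z[i] := by simp only [h]
    simpa [initSeg] using this

theorem eq_of_initSeg_eq {p q : ℕ → ℕ} (h : ∀ k, ∃ l ≥ k, initSeg p l = initSeg q l) : p = q := by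
  funext k
  obtain ⟨l, hl, e⟩ := h (k + 1)
  have := congrArg (List.take (k + 1)) e
  rw [initSeg_take p hl, initSeg_take q hl, initSeg_succ, initSeg_succ] at this
  simpa using (List.append_inj' this rfl).2

theorem exists_initSeg_eq {g : ℕ → List ℕ} (hl : ∀ k, (g k).length = k)
    (hg : ∀ k, (g (k + 1)).take k = g k) : ∃ p, ∀ k, initSeg p k = g k := by
  refine ⟨fun k => (g (k + 1))[k]'(by simp [hl]), fun k => ?_⟩
  induction k with
  | zero => simp [initSeg, List.eq_nil_of_length_eq_zero (hl 0)]
  | succ k ih =>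
    rw [initSeg_succ, ih]
    conv_rhs => rw [← List.take_length (l := g (k + 1)), hl]
    rw [← List.take_append_getElem (by simp [hl]), hg]

/-! ### Sons and branches in the tree of finite sequences -/

namespace SetTree

theorem isSon_finSeq {x s : List ℕ} : finSeq.IsSon x s ↔ ∃ n, s = x ++ [n] := by
  constructor
  · rintro ⟨⟨⟨t, rfl⟩, hne⟩, hmin⟩
    rcases t with _ | ⟨n, t⟩
    · simp at hne
    · refine ⟨n, ?_⟩
      by_contra h
      refine hmin ⟨x ++ [n], ⟨⟨[n], rfl⟩, by simp⟩, ⟨⟨t, by simp⟩, fun h' => h h'.symm⟩⟩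
  · rintro ⟨n, rfl⟩
    refine ⟨⟨⟨[n], rfl⟩, by simp⟩, ?_⟩
    rintro ⟨v, ⟨h1, h2⟩, ⟨h3, h4⟩⟩
    have l1 : x.length < v.length := by
      by_contra h
      exact h2 (h1.eq_of_length_le (by omega))
    have l2 : v.length < x.length + 1 := by
      by_contra h
      exact h4 (h3.eq_of_length_le (by simpa using h))
    omega

theorem exists_initSeg_of_isChain {B : Set (List ℕ)} (hB : IsChain finSeq.lt B) :
    ∃ x : ℕ → ℕ, B ⊆ Set.range (initSeg x) := by
  classical
  have hpre : ∀ s ∈ B, ∀ t ∈ B, ∀ (n : ℕ) (hs : n < s.length) (ht : n < t.length),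
      s[n] = t[n] := by
    intro s hs t ht n h1 h2
    by_cases hst : s = t
    · subst hst; rfl
    rcases hB hs ht hst with h | h
    · exact h.1.getElem h1
    · exact (h.1.getElem h2).symm
  -- Any long enough word of the chain gives the same entry. The value 0 is arbitrary and only used
  -- past the longest word of a bounded chain.
  refine ⟨fun n => if h : ∃ t ∈ B, n < t.length then h.choose[n]'h.choose_spec.2 else 0, ?_⟩
  intro t ht
  refine ⟨t.length, List.ext_getElem (by simp) fun n h1 h2 => ?_⟩
  have h : ∃ t ∈ B, n < t.length := ⟨t, ht, h2⟩
  simp only [initSeg, List.getElem_map, List.getElem_range]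
  rw [dif_pos h]
  exact hpre _ h.choose_spec.1 _ ht _ _ _

theorem isChain_range_initSeg (x : ℕ → ℕ) : IsChain finSeq.lt (Set.range (initSeg x)) := by
  rintro _ ⟨k, rfl⟩ _ ⟨l, rfl⟩ hne
  rcases le_total k l with h | h
  · exact Or.inl ⟨initSeg_prefix x h, hne⟩
  · exact Or.inr ⟨initSeg_prefix x h, hne.symm⟩

theorem exists_eq_range_initSeg_of_isBranch {B : Set (List ℕ)} (hB : finSeq.IsBranch B) :
    ∃ x : ℕ → ℕ, B = Set.range (initSeg x) := by
  obtain ⟨x, hx⟩ := exists_initSeg_of_isChain hB.1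
  exact ⟨x, hB.2 (isChain_range_initSeg x) hx⟩

end SetTree

/-! ### Two-word tracks and their limits -/

/-- `p` passes infinitely often to a good son. -/
def GoodInfinitelyOften (G : List ℕ → Set ℕ) (p : ℕ → ℕ) : Prop :=
  ∀ K, ∃ k ≥ K, p k ∈ G (initSeg p k)

/-- One step of a two-track search: the new main word is a good son of an old word; if a secondary
word is kept, then the main word moves to its own good son, and the new secondary word is a bad son
of an old word. -/
def TrackStep (G : List ℕ → Set ℕ) (w : List ℕ) (o : Option (List ℕ))
    (w' : List ℕ) (o' : Option (List ℕ)) : Prop :=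
  (∃ u m, (u = w ∨ u ∈ o) ∧ m ∈ G u ∧ w' = u ++ [m]) ∧
    ∀ b ∈ o', (∃ m ∈ G w, w' = w ++ [m]) ∧ ∃ u m, (u = w ∨ u ∈ o) ∧ m ∉ G u ∧ b = u ++ [m]

section Track

variable {G : List ℕ → Set ℕ} {w : ℕ → List ℕ} {o : ℕ → Option (List ℕ)}

theorem TrackStep.exists_parent {w w' : List ℕ} {o o' : Option (List ℕ)}
    (h : TrackStep G w o w' o') {z : List ℕ} (hz : z = w' ∨ z ∈ o') :
    ∃ u m, (u = w ∨ u ∈ o) ∧ z = u ++ [m] := by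
  rcases hz with rfl | hz
  · obtain ⟨u, m, h1, -, h2⟩ := h.1
    exact ⟨u, m, h1, h2⟩
  · obtain ⟨u, m, h1, -, h2⟩ := (h.2 z hz).2
    exact ⟨u, m, h1, h2⟩

theorem track_length (h0 : w 0 = []) (o0 : o 0 = none)
    (hT : ∀ k, TrackStep G (w k) (o k) (w (k + 1)) (o (k + 1))) (k : ℕ) :
    ∀ z, (z = w k ∨ z ∈ o k) → z.length = k := by
  induction k with
  | zero => simp [h0, o0]
  | succ k ih =>
    intro z hz
    obtain ⟨u, m, hu, rfl⟩ := (hT k).exists_parent hz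
    simp [ih u hu]

theorem track_take (h0 : w 0 = []) (o0 : o 0 = none)
    (hT : ∀ k, TrackStep G (w k) (o k) (w (k + 1)) (o (k + 1))) {k l : ℕ} (hkl : k ≤ l) :
    ∀ z, (z = w l ∨ z ∈ o l) → (z.take k = w k ∨ z.take k ∈ o k) := by
  induction l, hkl using Nat.le_induction with
  | base =>
    intro z hz
    rwa [List.take_of_length_le (track_length h0 o0 hT k z hz).le]
  | succ l hl ih =>
    intro z hz
    obtain ⟨u, m, hu, rfl⟩ := (hT l).exists_parent hz
    rw [List.take_append_of_le_length (by rw [track_length h0 o0 hT l u hu]; exact hl)]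
    exact ih u hu

/-- Either single-word levels recur, and their words cohere because all later words extend them, or
a secondary word is eventually always kept, and then the main words extend one another. -/
theorem exists_track_limit (h0 : w 0 = []) (o0 : o 0 = none)
    (hT : ∀ k, TrackStep G (w k) (o k) (w (k + 1)) (o (k + 1))) :
    ∃ p, (∀ k, initSeg p k = w k ∨ initSeg p k ∈ o k) ∧ ∀ K, ∃ k ≥ K, initSeg p k = w k := by
  have hlen : ∀ k, (w k).length = k := fun k => track_length h0 o0 hT k _ (Or.inl rfl)
  -- From level `L k` on, the main words agree in their first `k` entries, so these entries define
  -- the limit. The last clause says that at infinitely many levels the limit can only be at the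
  -- main word.
  have key : ∃ L : ℕ → ℕ, (∀ k, k ≤ L k) ∧ (∀ k l, L k ≤ l → (w l).take k = (w (L k)).take k) ∧
      ∀ K, ∃ k ≥ K, ∀ z, (z = w k ∨ z ∈ o k) → z = (w (L k)).take k → z = w k := by
    by_cases hc : ∀ K, ∃ k ≥ K, o k = none
    · choose L hL hLn using hc
      refine ⟨L, hL, fun k l hl => ?_, fun K => ⟨L K, hL K, fun z hz _ => ?_⟩⟩
      · have := track_take h0 o0 hT hl (w l) (Or.inl rfl)
        simp only [hLn, Option.mem_def, reduceCtorEq, or_false] at this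
        rw [← this, List.take_take, min_eq_left (hL k)]
      · simpa [hLn] using hz
    · push Not at hc
      obtain ⟨K, hK⟩ := hc
      have hpre : ∀ k l, K ≤ k → k ≤ l → w k <+: w l := by
        intro k l hk hl
        induction l, hl using Nat.le_induction with
        | base => exact List.prefix_refl _
        | succ l hl ih =>
          obtain ⟨b, hb⟩ := Option.ne_none_iff_exists'.1 (hK (l + 1) (by omega))
          obtain ⟨m, -, hm⟩ := ((hT l).2 b hb).1
          rw [hm]
          exact ih.trans (List.prefix_append _ _)
      refine ⟨fun k => max K k, fun k => le_max_right _ _, fun k l hl => ?_, fun K' =>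
        ⟨max K K', le_max_right _ _, fun z _ h => ?_⟩⟩
      · obtain ⟨t, ht⟩ := hpre _ _ (le_max_left K k) hl
        rw [← ht, List.take_append_of_le_length (by rw [hlen]; exact le_max_right _ _)]
      · simp only [h, max_eq_right (le_max_left K K'), List.take_of_length_le (hlen (max K K')).le]
  obtain ⟨L, hL, hst, hfr⟩ := key
  obtain ⟨p, hp⟩ := exists_initSeg_eq (g := fun k => (w (L k)).take k)
    (by intro k; simp [hlen, hL]) (by
      intro k
      have h1 := hst k (max (L k) (L (k + 1))) (le_max_left _ _)
      have h2 := hst (k + 1) (max (L k) (L (k + 1))) (le_max_right _ _)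
      rw [← h1, ← h2, List.take_take, min_eq_left (Nat.le_succ k)])
  have hF : ∀ k, initSeg p k = w k ∨ initSeg p k ∈ o k := fun k => by
    rw [hp]
    exact track_take h0 o0 hT (hL k) _ (Or.inl rfl)
  refine ⟨p, hF, fun K => ?_⟩
  obtain ⟨k, hk, h⟩ := hfr K
  exact ⟨k, hk, h _ (hF k) (hp k)⟩

theorem exists_goodInfinitelyOften_track (h0 : w 0 = []) (o0 : o 0 = none)
    (hT : ∀ k, TrackStep G (w k) (o k) (w (k + 1)) (o (k + 1))) :
    ∃ p, GoodInfinitelyOften G p ∧ ∀ k, initSeg p k = w k ∨ initSeg p k ∈ o k := by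
  obtain ⟨p, hF, hfr⟩ := exists_track_limit h0 o0 hT
  refine ⟨p, fun K => ?_, hF⟩
  -- A main word of length `k + 1` witnesses a good choice at position `k`, hence the shift from `K`
  -- to `K + 1`.
  obtain ⟨k, hk, hpk⟩ := hfr (K + 1)
  obtain ⟨k, rfl⟩ := Nat.exists_eq_add_of_lt (show 0 < k by omega)
  simp only [zero_add] at hk hpk
  obtain ⟨u, m, -, hm, hw⟩ := (hT k).1
  rw [hw, initSeg_succ_eq_append] at hpk
  exact ⟨k, by omega, by rw [hpk.1, hpk.2]; exact hm⟩

/-- Two separated sequences cannot exchange roles: both surviving the step forces a secondary word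
to be kept, so the main word stays with its own sequence and the other one makes a bad choice. -/
theorem TrackStep.secondary_succ {w w' : List ℕ} {o o' : Option (List ℕ)}
    (h : TrackStep G w o w' o') {p q : ℕ → ℕ} {k : ℕ}
    (hne : initSeg p k ≠ initSeg q k) (hne' : initSeg p (k + 1) ≠ initSeg q (k + 1))
    (hp' : initSeg p (k + 1) = w' ∨ initSeg p (k + 1) ∈ o')
    (hq' : initSeg q (k + 1) = w' ∨ initSeg q (k + 1) ∈ o') (hq : initSeg q k = w) :
    initSeg q (k + 1) = w' ∧ initSeg p (k + 1) ∈ o' ∧ p k ∉ G (initSeg p k) := by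
  obtain ⟨b, hb⟩ : ∃ b, b ∈ o' := by
    rcases hp' with hp' | hp'
    · rcases hq' with hq' | hq'
      · exact absurd (hp'.trans hq'.symm) hne'
      · exact ⟨_, hq'⟩
    · exact ⟨_, hp'⟩
  obtain ⟨⟨m, -, hm⟩, u, n, -, hn, hbu⟩ := h.2 b hb
  have hpb : initSeg p (k + 1) ∈ o' := by
    refine hp'.resolve_left fun hp' => hne ?_
    rw [hm, initSeg_succ_eq_append] at hp'
    rw [hp'.1, hq]
  have hpb' := Option.mem_unique hpb hb
  refine ⟨hq'.resolve_right fun hq' => hne' (Option.mem_unique hpb hq'), hpb, ?_⟩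
  rw [hbu, initSeg_succ_eq_append] at hpb'
  rwa [hpb'.1, hpb'.2]

theorem goodInfinitelyOften_track_unique
    (hT : ∀ k, TrackStep G (w k) (o k) (w (k + 1)) (o (k + 1))) {p q : ℕ → ℕ}
    (hp : GoodInfinitelyOften G p) (hq : GoodInfinitelyOften G q)
    (hpF : ∀ k, initSeg p k = w k ∨ initSeg p k ∈ o k)
    (hqF : ∀ k, initSeg q k = w k ∨ initSeg q k ∈ o k) : p = q := by
  by_contra hne
  obtain ⟨K, hK⟩ : ∃ K, ∀ k ≥ K, initSeg p k ≠ initSeg q k := by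
    by_contra h
    push Not at h
    exact hne (eq_of_initSeg_eq h)
  have main : ∀ p q : ℕ → ℕ, GoodInfinitelyOften G p →
      (∀ k, initSeg p k = w k ∨ initSeg p k ∈ o k) →
      (∀ k, initSeg q k = w k ∨ initSeg q k ∈ o k) →
      (∀ k ≥ K, initSeg p k ≠ initSeg q k) → initSeg q K = w K → False := by
    intro p q hp hpF hqF hK hqK
    have hqw : ∀ k ≥ K, initSeg q k = w k := by
      intro k hk
      induction k, hk using Nat.le_induction with
      | base => exact hqK
      | succ k hk ih =>
        exact ((hT k).secondary_succ (hK k hk) (hK _ (by omega)) (hpF _) (hqF _) ih).1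
    obtain ⟨k, hk, hg⟩ := hp K
    exact ((hT k).secondary_succ (hK k hk) (hK _ (by omega)) (hpF _) (hqF _) (hqw k hk)).2.2 hg
  rcases hqF K with h | h
  · exact main p q hp hpF hqF hK h
  · refine main q p hq hqF hpF (fun k hk => (hK k hk).symm) ?_
    exact (hpF K).resolve_right fun h' => hK K le_rfl (Option.mem_unique h' h)

end Track

/-! ### Cylinders and states -/

/-- The sequences extending a finite sequence. -/
def cyl (z : List ℕ) : Set (ℕ → ℕ) := {p | initSeg p z.length = z}

theorem cyl_eq_standard_leaf (z : List ℕ) : cyl z = FoliageTree.standard.leaf z := by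
  ext p
  exact mem_standard_leaf.symm

theorem mem_cyl_append {p : ℕ → ℕ} {u : List ℕ} {m : ℕ} :
    p ∈ cyl (u ++ [m]) ↔ p ∈ cyl u ∧ p u.length = m := by
  change initSeg p (u ++ [m]).length = _ ↔ initSeg p _ = _ ∧ _
  rw [List.length_append, List.length_singleton, initSeg_succ_eq_append]

theorem eq_of_mem_cyl {p : ℕ → ℕ} {z z' : List ℕ} (h : p ∈ cyl z) (h' : p ∈ cyl z')
    (hl : z.length = z'.length) : z = z' := by
  change initSeg p _ = _ at h h'
  rw [← h, ← h', hl]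

/-- The states from which the nodes of the new tree are built: `main w o` stands for the words `w`
and `o`; `splitMain w i b` for the `i`-th class of good sons of `w`, together with `b`;
`splitBoth w v i` for the `i`-th class of sons of two words `w` and `v`. -/
inductive TrackState
  | main (w : List ℕ) (o : Option (List ℕ))
  | splitMain (w : List ℕ) (i : ℕ) (b : Option (List ℕ))
  | splitBoth (w v : List ℕ) (i : ℕ)

namespace TrackState

variable (e : List ℕ → ℕ → ℕ → ℕ)

/-- The good sons: those enumerated by `e`. -/
def good (z : List ℕ) : Set ℕ := {m | ∃ i j, e z i j = m}

open Classical in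
/-- The `i`-th son of `w`, if it is bad. -/
noncomputable def badSon (w : List ℕ) (i : ℕ) : Option (List ℕ) :=
  if i ∈ good e w then none else some (w ++ [i])

/-- An enumeration of the bad sons of `w` and `v`. -/
noncomputable def badSonBoth (w v : List ℕ) (i : ℕ) : Option (List ℕ) :=
  if i % 2 = 0 then badSon e v (i / 2) else badSon e w (i / 2)

/-- The `n`-th son of a state. -/
noncomputable def step : TrackState → ℕ → TrackState
  | main w none, i => splitMain w i (badSon e w i)
  | main w (some v), i => splitBoth w v i
  | splitBoth w v i, 0 => splitMain w i (badSonBoth e w v i)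
  | splitBoth _ v i, j + 1 => main (v ++ [e v i j]) none
  | splitMain w i b, 0 => main (w ++ [e w i 0]) b
  | splitMain w i _, j + 1 => main (w ++ [e w i (j + 1)]) none

/-- The words of a state. -/
def words : TrackState → Set (List ℕ)
  | main w o => {z | z = w ∨ z ∈ o}
  | splitMain w i b => {z | (∃ j, z = w ++ [e w i j]) ∨ z ∈ b}
  | splitBoth w v i =>
    {z | (∃ j, z = v ++ [e v i j]) ∨ (∃ j, z = w ++ [e w i j]) ∨ z ∈ badSonBoth e w v i}

/-- The sequences which extend a word of the state. -/
def leaf (s : TrackState) : Set (ℕ → ℕ) := ⋃ z ∈ words e s, cyl z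

/-- The words of a state are listed without repetition and have the same length. -/
def Valid : TrackState → Prop
  | main w o => ∀ v ∈ o, v.length = w.length ∧ v ≠ w
  | splitMain w i b => ∀ z ∈ b, z.length = w.length + 1 ∧ ∀ j, z ≠ w ++ [e w i j]
  | splitBoth w v _ => v.length = w.length ∧ v ≠ w

variable {e}

theorem mem_badSon {w z : List ℕ} {i : ℕ} :
    z ∈ badSon e w i ↔ i ∉ good e w ∧ z = w ++ [i] := by
  unfold badSon
  split_ifs with h <;> simp [h, eq_comm]

theorem mem_badSonBoth {w v z : List ℕ} {i : ℕ} :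
    z ∈ badSonBoth e w v i ↔
      (∃ m, i = 2 * m ∧ m ∉ good e v ∧ z = v ++ [m]) ∨
        ∃ m, i = 2 * m + 1 ∧ m ∉ good e w ∧ z = w ++ [m] := by
  unfold badSonBoth
  split_ifs with h <;> rw [mem_badSon]
  · constructor
    · exact fun h' => Or.inl ⟨i / 2, by omega, h'⟩
    · rintro (⟨m, rfl, h'⟩ | ⟨m, rfl, h'⟩)
      · simpa using h'
      · omega
  · constructor
    · exact fun h' => Or.inr ⟨i / 2, by omega, h'⟩
    · rintro (⟨m, rfl, h'⟩ | ⟨m, rfl, h'⟩)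
      · omega
      · rwa [show (2 * m + 1) / 2 = m by omega]

theorem mem_leaf {s : TrackState} {p : ℕ → ℕ} : p ∈ leaf e s ↔ ∃ z ∈ words e s, p ∈ cyl z := by
  simp [leaf]

theorem Valid.step {s : TrackState} (hs : Valid e s) (n : ℕ) : Valid e (step e s n) := by
  match s, n, hs with
  | main w none, i, hs =>
    intro z hz
    obtain ⟨h, rfl⟩ := mem_badSon.1 hz
    refine ⟨by simp, fun j hj => h ⟨i, j, ?_⟩⟩
    simpa using hj.symm
  | main w (some v), i, hs => exact hs v rfl
  | splitBoth w v i, 0, hs =>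
    intro z hz
    rcases mem_badSonBoth.1 hz with ⟨m, -, h, rfl⟩ | ⟨m, -, h, rfl⟩
    · refine ⟨by simp [hs.1], fun j hj => hs.2 ?_⟩
      simpa using (List.append_inj' hj rfl).1
    · refine ⟨by simp, fun j hj => h ⟨i, j, ?_⟩⟩
      simpa using hj.symm
  | splitBoth _ v i, j + 1, hs => simp [TrackState.step, Valid]
  | splitMain w i b, 0, hs =>
    intro z hz
    exact ⟨by simp [(hs z hz).1], (hs z hz).2 0⟩
  | splitMain w i _, j + 1, hs => simp [TrackState.step, Valid]

theorem leaf_main {w : List ℕ} {o : Option (List ℕ)} {p : ℕ → ℕ} :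
    p ∈ leaf e (main w o) ↔ p ∈ cyl w ∨ ∃ v ∈ o, p ∈ cyl v := by
  simp [mem_leaf, words, or_and_right, exists_or]

theorem leaf_splitMain {w : List ℕ} {i : ℕ} {b : Option (List ℕ)} {p : ℕ → ℕ} :
    p ∈ leaf e (splitMain w i b) ↔
      (p ∈ cyl w ∧ ∃ j, p w.length = e w i j) ∨ ∃ z ∈ b, p ∈ cyl z := by
  simp only [mem_leaf, words, Set.mem_ofPred_eq, or_and_right, exists_or]
  refine or_congr ⟨?_, ?_⟩ Iff.rfl
  · rintro ⟨_, ⟨j, rfl⟩, h⟩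
    rw [mem_cyl_append] at h
    exact ⟨h.1, j, h.2⟩
  · rintro ⟨h, j, h'⟩
    exact ⟨_, ⟨j, rfl⟩, mem_cyl_append.2 ⟨h, h'⟩⟩

theorem leaf_splitBoth {w v : List ℕ} {i : ℕ} {p : ℕ → ℕ} :
    p ∈ leaf e (splitBoth w v i) ↔
      (p ∈ cyl v ∧ ((∃ j, p v.length = e v i j) ∨ i = 2 * p v.length ∧ p v.length ∉ good e v)) ∨
      (p ∈ cyl w ∧
        ((∃ j, p w.length = e w i j) ∨ i = 2 * p w.length + 1 ∧ p w.length ∉ good e w)) := by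
  simp only [mem_leaf, words, Set.mem_ofPred_eq, mem_badSonBoth]
  constructor
  · rintro ⟨_, ⟨j, rfl⟩ | ⟨j, rfl⟩ | ⟨m, rfl, hm, rfl⟩ | ⟨m, rfl, hm, rfl⟩, h⟩ <;>
      rw [mem_cyl_append] at h
    · exact Or.inl ⟨h.1, Or.inl ⟨j, h.2⟩⟩
    · exact Or.inr ⟨h.1, Or.inl ⟨j, h.2⟩⟩
    · exact Or.inl ⟨h.1, Or.inr ⟨by rw [h.2], by rwa [h.2]⟩⟩
    · exact Or.inr ⟨h.1, Or.inr ⟨by rw [h.2], by rwa [h.2]⟩⟩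
  · rintro (⟨h, ⟨j, hj⟩ | ⟨hi, hb⟩⟩ | ⟨h, ⟨j, hj⟩ | ⟨hi, hb⟩⟩)
    · exact ⟨_, Or.inl ⟨j, rfl⟩, mem_cyl_append.2 ⟨h, hj⟩⟩
    · exact ⟨_, Or.inr (Or.inr (Or.inl ⟨_, hi, hb, rfl⟩)), mem_cyl_append.2 ⟨h, rfl⟩⟩
    · exact ⟨_, Or.inr (Or.inl ⟨j, rfl⟩), mem_cyl_append.2 ⟨h, hj⟩⟩
    · exact ⟨_, Or.inr (Or.inr (Or.inr ⟨_, hi, hb, rfl⟩)), mem_cyl_append.2 ⟨h, rfl⟩⟩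

theorem leaf_badSon {w : List ℕ} {i : ℕ} {p : ℕ → ℕ} :
    (∃ z ∈ badSon e w i, p ∈ cyl z) ↔ p ∈ cyl w ∧ i = p w.length ∧ p w.length ∉ good e w := by
  simp only [mem_badSon]
  constructor
  · rintro ⟨_, ⟨hm, rfl⟩, h⟩
    rw [mem_cyl_append] at h
    exact ⟨h.1, h.2.symm, by rwa [h.2]⟩
  · rintro ⟨h, rfl, hm⟩
    exact ⟨_, ⟨hm, rfl⟩, mem_cyl_append.2 ⟨h, rfl⟩⟩

/-! ### The sons of a state partition its leaf -/

/-- Distinct indices are sent to distinct sons. -/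
def Separates (e : List ℕ → ℕ → ℕ → ℕ) : Prop :=
  ∀ z i j i' j', e z i j = e z i' j' → i = i' ∧ j = j'

theorem leaf_step_subset (s : TrackState) (n : ℕ) : leaf e (step e s n) ⊆ leaf e s := by
  intro p hp
  match s, n, hp with
  | main w none, i, hp =>
    rw [step, leaf_splitMain, leaf_badSon] at hp
    rw [leaf_main]
    tauto
  | main w (some v), i, hp =>
    rw [step, leaf_splitBoth] at hp
    rw [leaf_main]
    simp only [Option.mem_def, Option.some.injEq, exists_eq_left']
    tauto
  | splitBoth w v i, 0, hp =>
    rw [mem_leaf] at hp ⊢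
    obtain ⟨z, hz, hp⟩ := hp
    exact ⟨z, Or.inr hz, hp⟩
  | splitBoth w v i, j + 1, hp =>
    rw [mem_leaf] at hp ⊢
    obtain ⟨z, rfl | hz, hp⟩ := hp
    · exact ⟨_, Or.inl ⟨j, rfl⟩, hp⟩
    · simp at hz
  | splitMain w i b, 0, hp =>
    rw [mem_leaf] at hp ⊢
    obtain ⟨z, rfl | hz, hp⟩ := hp
    · exact ⟨_, Or.inl ⟨0, rfl⟩, hp⟩
    · exact ⟨_, Or.inr hz, hp⟩
  | splitMain w i b, j + 1, hp =>
    rw [mem_leaf] at hp ⊢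
    obtain ⟨z, rfl | hz, hp⟩ := hp
    · exact ⟨_, Or.inl ⟨j + 1, rfl⟩, hp⟩
    · simp at hz

theorem exists_mem_leaf_step {s : TrackState} {p : ℕ → ℕ} (hp : p ∈ leaf e s) :
    ∃ n, p ∈ leaf e (step e s n) := by
  match s, hp with
  | main w none, hp =>
    simp only [leaf_main, Option.mem_def, reduceCtorEq, false_and, exists_false, or_false] at hp
    simp only [step, leaf_splitMain, leaf_badSon]
    by_cases h : p w.length ∈ good e w
    · obtain ⟨i, j, h⟩ := h
      exact ⟨i, Or.inl ⟨hp, j, h.symm⟩⟩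
    · exact ⟨_, Or.inr ⟨hp, rfl, h⟩⟩
  | main w (some v), hp =>
    simp only [leaf_main, Option.mem_def, Option.some.injEq, exists_eq_left'] at hp
    simp only [step, leaf_splitBoth]
    rcases hp with hp | hp
    · by_cases h : p w.length ∈ good e w
      · obtain ⟨i, j, h⟩ := h
        exact ⟨i, Or.inr ⟨hp, Or.inl ⟨j, h.symm⟩⟩⟩
      · exact ⟨_, Or.inr ⟨hp, Or.inr ⟨rfl, h⟩⟩⟩
    · by_cases h : p v.length ∈ good e v
      · obtain ⟨i, j, h⟩ := h
        exact ⟨i, Or.inl ⟨hp, Or.inl ⟨j, h.symm⟩⟩⟩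
      · exact ⟨_, Or.inl ⟨hp, Or.inr ⟨rfl, h⟩⟩⟩
  | splitBoth w v i, hp =>
    rw [mem_leaf] at hp
    obtain ⟨z, ⟨j, rfl⟩ | hz, hp⟩ := hp
    · exact ⟨j + 1, mem_leaf.2 ⟨_, Or.inl rfl, hp⟩⟩
    · exact ⟨0, mem_leaf.2 ⟨z, hz, hp⟩⟩
  | splitMain w i b, hp =>
    rw [mem_leaf] at hp
    obtain ⟨z, ⟨_ | j, rfl⟩ | hz, hp⟩ := hp
    · exact ⟨0, mem_leaf.2 ⟨_, Or.inl rfl, hp⟩⟩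
    · exact ⟨j + 1, mem_leaf.2 ⟨_, Or.inl rfl, hp⟩⟩
    · exact ⟨0, mem_leaf.2 ⟨z, Or.inr hz, hp⟩⟩

theorem not_mem_cyl_of_mem_cyl {p : ℕ → ℕ} {w v : List ℕ} (hl : v.length = w.length)
    (hne : v ≠ w) (hw : p ∈ cyl w) : p ∉ cyl v :=
  fun hv => hne (eq_of_mem_cyl hv hw hl)

/-- Words of equal length with a common extension are equal. Thus an overlap would identify two
entries of `e`, a bad son with a good one, or the two words of the state, against `Separates`, the
definition of bad, or `Valid`. -/
theorem step_index_unique (he : Separates e) {s : TrackState} (hs : Valid e s) {p : ℕ → ℕ}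
    {n n' : ℕ} (hn : p ∈ leaf e (step e s n)) (hn' : p ∈ leaf e (step e s n')) : n = n' := by
  have single : ∀ u : List ℕ, p ∈ leaf e (main u none) ↔ p ∈ cyl u := fun u => by
    simp [leaf_main]
  match s, hs, hn, hn' with
  | main w none, hs, hn, hn' =>
    simp only [step, leaf_splitMain, leaf_badSon] at hn hn'
    rcases hn with ⟨-, j, hn⟩ | ⟨-, hn, hb⟩ <;> rcases hn' with ⟨-, j', hn'⟩ | ⟨-, hn', hb'⟩
    · exact (he _ _ _ _ _ (hn.symm.trans hn')).1
    · exact absurd ⟨_, _, hn.symm⟩ hb'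
    · exact absurd ⟨_, _, hn'.symm⟩ hb
    · exact hn.trans hn'.symm
  | main w (some v), hs, hn, hn' =>
    simp only [step, leaf_splitBoth] at hn hn'
    have key : ∀ (u : List ℕ) (a : ℕ),
        ((∃ j, p u.length = e u n j) ∨ n = a ∧ p u.length ∉ good e u) →
        ((∃ j, p u.length = e u n' j) ∨ n' = a ∧ p u.length ∉ good e u) → n = n' := by
      rintro u a (⟨j, hn⟩ | ⟨hn, hb⟩) (⟨j', hn'⟩ | ⟨hn', hb'⟩)
      · exact (he _ _ _ _ _ (hn.symm.trans hn')).1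
      · exact absurd ⟨_, _, hn.symm⟩ hb'
      · exact absurd ⟨_, _, hn'.symm⟩ hb
      · exact hn.trans hn'.symm
    have hvw := hs v rfl
    rcases hn with ⟨hp, hn⟩ | ⟨hp, hn⟩ <;> rcases hn' with ⟨hp', hn'⟩ | ⟨hp', hn'⟩
    · exact key v _ hn hn'
    · exact absurd hp (not_mem_cyl_of_mem_cyl hvw.1 hvw.2 hp')
    · exact absurd hp' (not_mem_cyl_of_mem_cyl hvw.1 hvw.2 hp)
    · exact key w _ hn hn'
  | splitBoth w v i, hs, hn, hn' =>
    have key : ∀ j, p ∈ leaf e (splitMain w i (badSonBoth e w v i)) →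
        p ∉ cyl (v ++ [e v i j]) := by
      intro j h h'
      obtain ⟨z, ⟨j', rfl⟩ | hz, hp⟩ := mem_leaf.1 h
      · exact hs.2 (by simpa using (List.append_inj' (eq_of_mem_cyl h' hp (by simp [hs.1])) rfl).1)
      · rcases mem_badSonBoth.1 hz with ⟨m, -, hb, rfl⟩ | ⟨m, -, hb, rfl⟩
        · refine hb ⟨i, j, ?_⟩
          simpa using eq_of_mem_cyl h' hp (by simp)
        · exact hs.2
            (by simpa using (List.append_inj' (eq_of_mem_cyl h' hp (by simp [hs.1])) rfl).1)
    rcases n with _ | j <;> rcases n' with _ | j' <;> simp only [step, single] at hn hn'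
    · rfl
    · exact absurd hn' (key _ hn)
    · exact absurd hn (key _ hn')
    · have := eq_of_mem_cyl hn hn' (by simp)
      rw [(he v i j i j' (by simpa using this)).2]
  | splitMain w i b, hs, hn, hn' =>
    have key : ∀ j, p ∈ leaf e (main (w ++ [e w i 0]) b) → p ∉ cyl (w ++ [e w i (j + 1)]) := by
      intro j h h'
      obtain ⟨z, rfl | hz, hp⟩ := mem_leaf.1 h
      · have := he w i (j + 1) i 0 (by simpa using eq_of_mem_cyl h' hp (by simp))
        simp at this
      · exact (hs z hz).2 (j + 1) (eq_of_mem_cyl hp h' (by simp [(hs z hz).1]))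
    rcases n with _ | j <;> rcases n' with _ | j' <;> simp only [step, single] at hn hn'
    · rfl
    · exact absurd hn' (key _ hn)
    · exact absurd hn (key _ hn')
    · have := eq_of_mem_cyl hn hn' (by simp)
      rw [(he w i (j + 1) i (j' + 1) (by simpa using this)).2]

/-! ### Each branch of states contains one point of `Y` -/

theorem trackStep_splitMain {w : List ℕ} {i : ℕ} {b o : Option (List ℕ)}
    (hb : ∀ z ∈ b, ∃ u m, (u = w ∨ u ∈ o) ∧ m ∉ good e u ∧ z = u ++ [m]) (n : ℕ) :
    ∃ w' o', step e (splitMain w i b) n = main w' o' ∧ TrackStep (good e) w o w' o' := by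
  rcases n with _ | j
  · exact ⟨_, _, rfl, ⟨w, _, Or.inl rfl, ⟨i, 0, rfl⟩, rfl⟩,
      fun z hz => ⟨⟨_, ⟨i, 0, rfl⟩, rfl⟩, hb z hz⟩⟩
  · exact ⟨_, _, rfl, ⟨w, _, Or.inl rfl, ⟨i, j + 1, rfl⟩, rfl⟩, fun z hz => by simp at hz⟩

/-- Split states only interpolate: the next `main` state comes after two steps, or three when a
secondary word is present and the son 0 of `splitBoth` is taken. -/
theorem exists_next_main {σ : ℕ → TrackState} {x : ℕ → ℕ}
    (hσ : ∀ t, σ (t + 1) = step e (σ t) (x t)) {t : ℕ} {w : List ℕ} {o : Option (List ℕ)}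
    (ht : σ t = main w o) :
    ∃ t' w' o', t < t' ∧ σ t' = main w' o' ∧ TrackStep (good e) w o w' o' := by
  have h1 := hσ t
  have h2 := hσ (t + 1)
  rw [ht] at h1
  rcases o with _ | v
  · rw [h1, step] at h2
    obtain ⟨w', o', h, hT⟩ := trackStep_splitMain (e := e) (w := w) (i := x t)
      (b := badSon e w (x t)) (o := none)
      (fun z hz => ⟨w, _, Or.inl rfl, mem_badSon.1 hz⟩) (x (t + 1))
    exact ⟨t + 2, w', o', by omega, h2.trans h, hT⟩
  · rw [h1, step] at h2
    rcases hx : x (t + 1) with _ | j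
    · rw [hx, step] at h2
      have h3 := hσ (t + 2)
      rw [h2] at h3
      obtain ⟨w', o', h, hT⟩ := trackStep_splitMain (e := e) (w := w) (i := x t)
        (b := badSonBoth e w v (x t)) (o := some v) (fun z hz => by
          rcases mem_badSonBoth.1 hz with ⟨m, -, h⟩ | ⟨m, -, h⟩
          · exact ⟨v, m, Or.inr rfl, h⟩
          · exact ⟨w, m, Or.inl rfl, h⟩) (x (t + 2))
      exact ⟨t + 3, w', o', by omega, h3.trans h, hT⟩
    · rw [hx, step] at h2
      exact ⟨t + 2, _, _, by omega, h2, ⟨v, _, Or.inr rfl, ⟨_, j, rfl⟩, rfl⟩,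
        fun z hz => by simp at hz⟩

theorem existsUnique_mem_leaf {σ : ℕ → TrackState} {x : ℕ → ℕ}
    (h0 : σ 0 = main [] none) (hσ : ∀ t, σ (t + 1) = step e (σ t) (x t)) :
    ∃! p, GoodInfinitelyOften (good e) p ∧ ∀ t, p ∈ leaf e (σ t) := by
  have hnext : ∀ a : {a : ℕ × List ℕ × Option (List ℕ) // σ a.1 = main a.2.1 a.2.2},
      ∃ b : {a : ℕ × List ℕ × Option (List ℕ) // σ a.1 = main a.2.1 a.2.2},
        a.1.1 < b.1.1 ∧ TrackStep (good e) a.1.2.1 a.1.2.2 b.1.2.1 b.1.2.2 := by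
    rintro ⟨⟨t, w, o⟩, ht⟩
    obtain ⟨t', w', o', hlt, ht', hT⟩ := exists_next_main hσ ht
    exact ⟨⟨⟨t', w', o'⟩, ht'⟩, hlt, hT⟩
  choose next hlt hT using hnext
  let a : ℕ → {a : ℕ × List ℕ × Option (List ℕ) // σ a.1 = main a.2.1 a.2.2} :=
    fun k => Nat.rec ⟨⟨0, [], none⟩, h0⟩ (fun _ => next) k
  have hmono : StrictMono fun k => (a k).1.1 := strictMono_nat_of_lt_succ fun k => hlt (a k)
  have hT' : ∀ k, TrackStep (good e) (a k).1.2.1 (a k).1.2.2 (a (k + 1)).1.2.1 (a (k + 1)).1.2.2 :=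
    fun k => hT (a k)
  have hanti : Antitone fun t => leaf e (σ t) := antitone_nat_of_succ_le fun t => by
    rw [hσ]
    exact leaf_step_subset _ _
  have hlen : ∀ k, ∀ z, (z = (a k).1.2.1 ∨ z ∈ (a k).1.2.2) → z.length = k :=
    track_length (w := fun k => (a k).1.2.1) (o := fun k => (a k).1.2.2) rfl rfl hT'
  -- Leaves decrease and the `main` states are cofinal in the branch, so the split states impose no
  -- further condition.
  have hiff : ∀ p, (∀ t, p ∈ leaf e (σ t)) ↔
      ∀ k, initSeg p k = (a k).1.2.1 ∨ initSeg p k ∈ (a k).1.2.2 := by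
    intro p
    have hk : ∀ k, p ∈ leaf e (σ (a k).1.1) ↔
        (initSeg p k = (a k).1.2.1 ∨ initSeg p k ∈ (a k).1.2.2) := by
      intro k
      rw [(a k).2, mem_leaf]
      constructor
      · rintro ⟨z, hz, hp⟩
        change initSeg p _ = z at hp
        rw [hlen k z hz] at hp
        rw [hp]
        exact hz
      · intro h
        refine ⟨_, h, ?_⟩
        change initSeg p _ = _
        rw [initSeg_length]
    constructor
    · exact fun h k => (hk k).1 (h _)
    · exact fun h t => hanti (hmono.le_apply (x := t)) ((hk t).2 (h t))
  obtain ⟨p, hp, hpF⟩ := exists_goodInfinitelyOften_track (G := good e)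
    (w := fun k => (a k).1.2.1) (o := fun k => (a k).1.2.2) rfl rfl hT'
  refine ⟨p, ⟨hp, (hiff p).2 hpF⟩, fun q hq => ?_⟩
  exact goodInfinitelyOften_track_unique hT' hq.1 hp ((hiff q).1 hq.2) hpF

variable (e) in
/-- The state at a node of the new tree. -/
noncomputable def stateAt (x : List ℕ) : TrackState := x.foldl (step e) (main [] none)

theorem stateAt_append_singleton (x : List ℕ) (n : ℕ) :
    stateAt e (x ++ [n]) = step e (stateAt e x) n := by
  simp [stateAt]

theorem valid_stateAt (x : List ℕ) : Valid e (stateAt e x) := by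
  induction x using List.reverseRecOn with
  | nil => simp [stateAt, Valid]
  | append_singleton x n ih =>
    rw [stateAt_append_singleton]
    exact ih.step n

theorem existsUnique_mem_leaf_stateAt (x : ℕ → ℕ) :
    ∃! p, GoodInfinitelyOften (good e) p ∧ ∀ t, p ∈ leaf e (stateAt e (initSeg x t)) :=
  existsUnique_mem_leaf rfl fun t => by rw [initSeg_succ, stateAt_append_singleton]

/-- Used for the nonemptiness demanded by π-refinement. The point comes from the branch that extends
`y` by zeros. -/
theorem exists_mem_leaf_stateAt (y : List ℕ) :
    ∃ p, GoodInfinitelyOften (good e) p ∧ p ∈ leaf e (stateAt e y) := by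
  obtain ⟨p, ⟨hp, h⟩, -⟩ := existsUnique_mem_leaf_stateAt (e := e) (fun n => y.getD n 0)
  refine ⟨p, hp, ?_⟩
  have : initSeg (fun n => y.getD n 0) y.length = y :=
    List.ext_getElem (by simp) fun n h1 h2 => by simp [initSeg, h2]
  have h' := h y.length
  rwa [this] at h'

/-! ### Nodes that handle the initial segments of a sequence -/

/-- Cofinitely many sons of the state lie in the sons of `z` from any given index on. -/
def Handles (e : List ℕ → ℕ → ℕ → ℕ) (s : TrackState) (z : List ℕ) : Prop :=
  ∀ N, {n | ¬ leaf e (step e s n) ⊆ ⋃ i ≥ N, cyl (z ++ [i])}.Finite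

/-- The exceptions are the son 0 and, by injectivity of `f`, the finitely many `j` with `f j < N`.
-/
theorem handles_of_step_succ {s : TrackState} {z : List ℕ} {f : ℕ → ℕ}
    (hs : ∀ j, step e s (j + 1) = main (z ++ [f j]) none)
    (hinj : f.Injective) : Handles e s z := by
  intro N
  have hfin : {j | f j < N}.Finite := (Set.finite_lt_nat N).preimage hinj.injOn
  refine ((hfin.image Nat.succ).insert 0).subset fun n hn => ?_
  rcases n with _ | j
  · exact Or.inl rfl
  · refine Or.inr ⟨j, ?_, rfl⟩
    by_contra hj
    refine hn fun p hp => ?_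
    rw [hs, mem_leaf] at hp
    obtain ⟨_, rfl | h, hp⟩ := hp
    · exact Set.mem_biUnion (show f j ≥ N from not_lt.1 hj) hp
    · simp at h

theorem handles_splitMain (he : Separates e) (w : List ℕ) (i : ℕ) (b : Option (List ℕ)) :
    Handles e (splitMain w i b) w :=
  handles_of_step_succ (f := fun j => e w i (j + 1)) (fun _ => rfl)
    fun _ _ h => by simpa using (he _ _ _ _ _ h).2

theorem handles_splitBoth (he : Separates e) (w v : List ℕ) (i : ℕ) :
    Handles e (splitBoth w v i) v :=
  handles_of_step_succ (f := fun j => e v i j) (fun _ => rfl)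
    fun _ _ h => (he _ _ _ _ _ h).2

theorem exists_mem_leaf_stateAt_append {p : ℕ → ℕ} {y : List ℕ} (hp : p ∈ leaf e (stateAt e y)) :
    ∃ n, p ∈ leaf e (stateAt e (y ++ [n])) ∧
      stateAt e (y ++ [n]) = step e (stateAt e y) n := by
  obtain ⟨n, hn⟩ := exists_mem_leaf_step hp
  exact ⟨n, by rwa [stateAt_append_singleton], stateAt_append_singleton _ _⟩

theorem exists_splitMain_next {p : ℕ → ℕ} {y w : List ℕ} {i : ℕ} {b : Option (List ℕ)}
    (hy : stateAt e y = splitMain w i b) (hp : p ∈ leaf e (stateAt e y)) :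
    ∃ y' w' o', stateAt e y' = main w' o' ∧ w'.length = w.length + 1 ∧
      p ∈ leaf e (stateAt e y') := by
  obtain ⟨n, hn, hn'⟩ := exists_mem_leaf_stateAt_append hp
  rw [hy] at hn'
  rcases n with _ | j
  · exact ⟨_, _, _, hn', by simp, hn⟩
  · exact ⟨_, _, _, hn', by simp, hn⟩

/-- If `p` extends the secondary word `v`, the `splitBoth` node handles it. If `p` extends `w`, it
must go to the son 0, a `splitMain` node that handles `w`. Either way `p` reaches a `main` state one
letter longer, which drives the induction in `exists_handles`. -/
theorem exists_handles_next (he : Separates e) {p : ℕ → ℕ} {y w : List ℕ} {o : Option (List ℕ)}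
    (hy : stateAt e y = main w o) (hp : p ∈ leaf e (stateAt e y)) :
    (∃ y', p ∈ leaf e (stateAt e y') ∧ Handles e (stateAt e y') (initSeg p w.length)) ∧
      ∃ y' w' o', stateAt e y' = main w' o' ∧ w'.length = w.length + 1 ∧
        p ∈ leaf e (stateAt e y') := by
  have hv := valid_stateAt (e := e) y
  obtain ⟨i, hi, hi'⟩ := exists_mem_leaf_stateAt_append hp
  rw [hy] at hi' hp hv
  rcases o with _ | v
  · have hpw : initSeg p w.length = w := by simpa [leaf_main, cyl] using hp
    rw [step] at hi'
    exact ⟨⟨_, hi, by rw [hpw, hi']; exact handles_splitMain he _ _ _⟩,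
      exists_splitMain_next hi' hi⟩
  · obtain ⟨hl, hne⟩ := hv v rfl
    rw [step] at hi'
    obtain ⟨j, hj, hj'⟩ := exists_mem_leaf_stateAt_append hi
    rw [hi'] at hj'
    refine ⟨?_, ?_⟩
    · have hpwv : p ∈ cyl w ∨ p ∈ cyl v := by simpa [leaf_main] using hp
      rcases hpwv with hpw | hpv
      · rcases j with _ | j
        · have hpw' : initSeg p w.length = w := hpw
          rw [step] at hj'
          exact ⟨_, hj, by rw [hpw', hj']; exact handles_splitMain he _ _ _⟩
        · rw [hj', mem_leaf] at hj
          obtain ⟨_, rfl | h, hpz⟩ := hj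
          · exact absurd (mem_cyl_append.1 hpz).1 (not_mem_cyl_of_mem_cyl hl hne hpw)
          · simp at h
      · have hpv' : initSeg p w.length = v := by rw [← hl]; exact hpv
        exact ⟨_, hi, by rw [hpv', hi']; exact handles_splitBoth he _ _ _⟩
    · rcases j with _ | j
      · exact exists_splitMain_next hj' hj
      · exact ⟨_, _, _, hj', by simp [hl], hj⟩

theorem exists_handles (he : Separates e) (p : ℕ → ℕ) (k : ℕ) :
    ∃ y, p ∈ leaf e (stateAt e y) ∧ Handles e (stateAt e y) (initSeg p k) := by
  have main : ∃ y w o, stateAt e y = main w o ∧ w.length = k ∧ p ∈ leaf e (stateAt e y) := by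
    induction k with
    | zero => exact ⟨[], [], none, rfl, rfl, leaf_main.2 (Or.inl rfl)⟩
    | succ k ih =>
      obtain ⟨y, w, o, hy, rfl, hp⟩ := ih
      exact (exists_handles_next he hy hp).2
  obtain ⟨y, w, o, hy, rfl, hp⟩ := main
  exact (exists_handles_next he hy hp).1

/-! ### The foliage tree on `Y` -/

/-- The foliage tree of the leaves of the states at the finite sequences, traced on `Y`. -/
noncomputable def foliage (e : List ℕ → ℕ → ℕ → ℕ) (Y : Set (ℕ → ℕ)) : FoliageTree.{0, 0} Y where
  toSetTree := SetTree.finSeq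
  leaf x := Subtype.val ⁻¹' leaf e (stateAt e x)

theorem sons_foliage {Y : Set (ℕ → ℕ)} (x : List ℕ) :
    (foliage e Y).sons x = Set.range fun n => x ++ [n] := by
  ext s
  refine (SetTree.isSon_finSeq (x := x) (s := s)).trans ?_
  exact exists_congr fun n => eq_comm

theorem isBaireOn_foliage (he : Separates e) {Y : Set (ℕ → ℕ)}
    (hY : ∀ p, p ∈ Y ↔ GoodInfinitelyOften (good e) p) {τ : TopologicalSpace (ℕ → ℕ)}
    (hτ : FoliageTree.standard.IsOpenIn τ) :
    (foliage e Y).IsBaireOn (TopologicalSpace.induced (Subtype.val : Y → (ℕ → ℕ)) τ) where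
  isOpenIn x := by
    refine ⟨leaf e (stateAt e x), ?_, rfl⟩
    refine @isOpen_biUnion _ _ τ _ _ fun z _ => ?_
    rw [cyl_eq_standard_leaf]
    exact hτ z
  isLocallyStrict (x : List ℕ) _ := by
    rw [show (foliage e Y).sons x = _ from sons_foliage x]
    constructor
    · refine Set.Subset.antisymm (fun p hp => ?_) (Set.iUnion₂_subset ?_)
      · obtain ⟨n, hn, -⟩ := exists_mem_leaf_stateAt_append hp
        exact Set.mem_biUnion (Set.mem_range_self n) hn
      · rintro _ ⟨n, rfl⟩ p hp
        change p.1 ∈ leaf e (stateAt e (x ++ [n])) at hp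
        rw [stateAt_append_singleton] at hp
        exact leaf_step_subset _ _ hp
    · rintro _ ⟨n, rfl⟩ _ ⟨n', rfl⟩ hne
      refine Set.disjoint_left.2 fun p hp hp' => hne ?_
      change p.1 ∈ leaf e (stateAt e (x ++ [n])) at hp
      change p.1 ∈ leaf e (stateAt e (x ++ [n'])) at hp'
      rw [stateAt_append_singleton] at hp hp'
      exact congrArg (fun n => x ++ [n]) (step_index_unique he (valid_stateAt x) hp hp')
  isOmegaAlephNullTree := ⟨RelIso.refl _⟩
  hasStrictBranches := by
    refine ⟨⟨([] : List ℕ)⟩, fun B hB => ?_⟩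
    obtain ⟨x, rfl⟩ := SetTree.exists_eq_range_initSeg_of_isBranch hB
    obtain ⟨p, ⟨hp, hpl⟩, hpu⟩ := existsUnique_mem_leaf_stateAt (e := e) x
    refine ⟨⟨p, (hY p).2 hp⟩, ?_⟩
    ext q
    simp only [FoliageTree.fruit, Set.mem_iInter, Set.mem_singleton_iff]
    constructor
    · exact fun hq => Subtype.ext (hpu q ⟨(hY q).1 q.2, fun t => hq _ ⟨t, rfl⟩⟩)
    · rintro rfl _ ⟨t, rfl⟩
      exact hpl t
  leaf_least := by
    refine ⟨([] : List ℕ), fun x => ?_, ?_⟩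
    · by_cases h : x = ([] : List ℕ)
      · exact Or.inl h
      · exact Or.inr ⟨List.nil_prefix, fun h' => h h'.symm⟩
    · exact Set.eq_univ_of_forall fun p => leaf_main.2 (Or.inl rfl)

theorem exists_iUnion_cyl_subset {τ : TopologicalSpace (ℕ → ℕ)}
    (hτ : FoliageTree.standard.GrowsInto τ) {p : ℕ → ℕ} {W : Set (ℕ → ℕ)}
    (hW : W ∈ @nhds _ τ p) :
    ∃ z : List ℕ, p ∈ cyl z ∧ ∃ N, (⋃ i ≥ N, cyl (z ++ [i])) ⊆ W := by
  obtain ⟨(z : List ℕ), hpz, hz⟩ := hτ p W hW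
  obtain ⟨_, ⟨⟨C, hC, hfin, rfl⟩, -⟩, hCW⟩ := hz W
    ⟨rfl, Set.Nonempty.ne_empty ⟨p, @mem_of_mem_nhds _ τ p W hW⟩⟩
  refine ⟨z, mem_standard_leaf.1 hpz, ?_⟩
  -- Only finitely many sons of `z` are missing from `C`, so `C` contains all sons of index above
  -- some `M`.
  have hfin' : {n : ℕ | (z ++ [n]) ∉ C}.Finite :=
    Set.Finite.subset (hfin.preimage (f := fun n => z ++ [n])
      (fun a _ b _ h => by simpa using List.append_cancel_left h))
      fun n hn => ⟨SetTree.isSon_finSeq.2 ⟨n, rfl⟩, hn⟩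
  obtain ⟨M, hM⟩ := hfin'.bddAbove
  refine ⟨M + 1, Set.iUnion₂_subset fun n hn => subset_trans ?_ hCW⟩
  rw [cyl_eq_standard_leaf]
  refine Set.subset_biUnion_of_mem (u := FoliageTree.standard.leaf) ?_
  by_contra h
  exact absurd (hM h) (by omega)

theorem growsInto_foliage (he : Separates e) {Y : Set (ℕ → ℕ)}
    (hY : ∀ p, p ∈ Y ↔ GoodInfinitelyOften (good e) p) {τ : TopologicalSpace (ℕ → ℕ)}
    (hτ : FoliageTree.standard.GrowsInto τ) :
    (foliage e Y).GrowsInto (TopologicalSpace.induced (Subtype.val : Y → (ℕ → ℕ)) τ) := by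
  intro p V hV
  rw [@nhds_induced _ _ τ] at hV
  obtain ⟨W, hW, hWV⟩ := hV
  obtain ⟨z, hpz, N, hW'⟩ := exists_iUnion_cyl_subset hτ hW
  obtain ⟨y, hpy, hy⟩ := exists_handles he p.1 z.length
  rw [show initSeg p.1 z.length = z from hpz] at hy
  have hyN := hy N
  refine ⟨y, hpy, ?_⟩
  rintro _ ⟨rfl, -⟩
  -- These sons of `y` are cofinitely many since `y` handles `z`; here `good` does not refer to good
  -- sons of words.
  let good : Set ℕ := {n | leaf e (stateAt e (y ++ [n])) ⊆ ⋃ i ≥ N, cyl (z ++ [i])}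
  have hgood : goodᶜ.Finite := hyN.subset fun n hn => by
    simpa [good, stateAt_append_singleton] using hn
  refine ⟨(foliage e Y).flesh ((fun n => (y ++ [n] : List ℕ)) '' good), ⟨⟨_, ?_, ?_, rfl⟩, ?_⟩, ?_⟩
  · rw [sons_foliage]
    exact Set.image_subset_range _ _
  · rw [sons_foliage]
    refine (hgood.image fun n => (y ++ [n] : List ℕ)).subset ?_
    rintro _ ⟨⟨n, rfl⟩, hn⟩
    exact ⟨n, fun h => hn ⟨n, h, rfl⟩, rfl⟩
  · obtain ⟨n, hn⟩ := hgood.infinite_compl.nonempty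
    rw [compl_compl] at hn
    obtain ⟨q, hq, hqn⟩ := exists_mem_leaf_stateAt (e := e) (y ++ [n])
    refine Set.Nonempty.ne_empty ⟨⟨q, (hY q).2 hq⟩, ?_⟩
    exact Set.mem_biUnion (Set.mem_image_of_mem _ hn) hqn
  · refine Set.iUnion₂_subset ?_
    rintro _ ⟨n, hn, rfl⟩ q hq
    exact hWV (hW' (hn hq))

end TrackState

/-! ### Good sons from the open π-dense sets -/

section Level

variable (U : ℕ → Set (ℕ → ℕ))

open Classical in
/-- The number of initial sets `U i` containing all sequences which extend `z`, cut at the length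
of `z`. -/
noncomputable def level (z : List ℕ) : ℕ :=
  Nat.findGreatest (fun k => ∀ i < k, cyl z ⊆ U i) z.length

/-- The sons of larger level. -/
def levelUp (z : List ℕ) : Set ℕ := {n | level U z < level U (z ++ [n])}

variable {U}

theorem cyl_subset_of_lt_level {z : List ℕ} {i : ℕ} (h : i < level U z) : cyl z ⊆ U i := by
  classical
  exact Nat.findGreatest_spec (P := fun k => ∀ i < k, cyl z ⊆ U i) (Nat.zero_le z.length)
    (by simp) i h

theorem level_le_length (z : List ℕ) : level U z ≤ z.length := by
  classical
  exact Nat.findGreatest_le _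

theorem le_level {z : List ℕ} {k : ℕ} (hk : k ≤ z.length) (h : ∀ i < k, cyl z ⊆ U i) :
    k ≤ level U z := by
  classical
  exact Nat.le_findGreatest (P := fun k => ∀ i < k, cyl z ⊆ U i) hk h

theorem cyl_initSeg_anti (p : ℕ → ℕ) : Antitone fun k => cyl (initSeg p k) := by
  intro k l h q hq
  simp only [cyl, Set.mem_ofPred_eq, initSeg_length] at hq ⊢
  rw [← initSeg_take q h, hq, initSeg_take p h]

theorem level_initSeg_mono (p : ℕ → ℕ) : Monotone fun k => level U (initSeg p k) := by
  intro k l h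
  refine le_level ((level_le_length _).trans (by simpa using h)) fun i hi => ?_
  exact (cyl_initSeg_anti p h).trans (cyl_subset_of_lt_level hi)

/-- Density is applied to the first set not yet counted. The cut at the length does not block the
increase: `level U z` is at most the length of `z`, and a son is one letter longer. -/
theorem infinite_levelUp (hU : ∀ n, IsPiDense (U n)) (z : List ℕ) : (levelUp U z).Infinite := by
  refine (hU (level U z) z).mono fun n hn => ?_
  have hn' : cyl (z ++ [n]) ⊆ U (level U z) := by
    rw [cyl_eq_standard_leaf]
    exact hn
  refine Nat.lt_of_succ_le (le_level (by simpa using level_le_length z) fun i hi => ?_)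
  rcases (Nat.lt_succ_iff_lt_or_eq.1 hi) with hi | rfl
  · exact subset_trans (fun p hp => (mem_cyl_append.1 hp).1) (cyl_subset_of_lt_level hi)
  · exact hn'

theorem exists_cyl_initSeg_subset {A : Set (ℕ → ℕ)} (hA : IsOpen A) {p : ℕ → ℕ} (hp : p ∈ A) :
    ∃ k, cyl (initSeg p k) ⊆ A := by
  obtain ⟨I, u, hu, hI⟩ := isOpen_pi_iff.1 hA p hp
  refine ⟨I.sup id + 1, fun q hq => hI fun a ha => ?_⟩
  simp only [cyl, Set.mem_ofPred_eq, initSeg_length] at hq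
  have hlt : a < I.sup id + 1 := Nat.lt_succ_of_le (Finset.le_sup (f := id) ha)
  have : q a = p a := by
    have h1 := (congrArg (List.take (a + 1)) hq)
    rw [initSeg_take _ hlt, initSeg_take _ hlt, initSeg_succ, initSeg_succ] at h1
    simpa using (List.append_inj' h1 rfl).2
  rw [this]
  exact (hu a ha).2

/-- Both sides say that the level is unbounded along `p`; openness is what makes the level of a
point of the intersection grow. -/
theorem mem_iInter_iff_goodInfinitelyOften (hU : ∀ n, IsOpen (U n)) (p : ℕ → ℕ) :
    p ∈ ⋂ n, U n ↔ GoodInfinitelyOften (levelUp U) p := by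
  rw [Set.mem_iInter]
  constructor
  · intro hp K
    by_contra h
    push Not at h
    have hconst : ∀ k ≥ K, level U (initSeg p k) ≤ level U (initSeg p K) := by
      intro k hk
      induction k, hk using Nat.le_induction with
      | base => exact le_rfl
      | succ k hk ih =>
        have := h k hk
        simp only [levelUp, Set.mem_ofPred_eq, not_lt, ← initSeg_succ] at this
        exact this.trans ih
    choose f hf using fun n => exists_cyl_initSeg_subset (hU n) (hp n)
    set c := level U (initSeg p K)
    -- Beyond `K` the level stays at most `c`; length at least `c + 1` makes the cut harmless;
    -- passing `f i` for all `i ≤ c` puts the cylinder inside `U 0, …, U c`.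
    set k := max (max K (c + 1)) ((Finset.range (c + 1)).sup f)
    have h1 := hconst k (le_trans (le_max_left _ _) (le_max_left _ _))
    have h2 : c + 1 ≤ level U (initSeg p k) := by
      refine le_level (by
        rw [initSeg_length]
        exact le_trans (le_max_right _ _) (le_max_left _ _)) fun i hi => ?_
      refine subset_trans (cyl_initSeg_anti p ?_) (hf i)
      exact le_trans (Finset.le_sup (f := f) (Finset.mem_range.2 hi)) (le_max_right _ _)
    omega
  · intro hp n
    have hgrow : ∀ c, ∃ k, c ≤ level U (initSeg p k) := by
      intro c
      induction c with
      | zero => exact ⟨0, Nat.zero_le _⟩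
      | succ c ih =>
        obtain ⟨k, hk⟩ := ih
        obtain ⟨l, hl, hup⟩ := hp k
        rw [levelUp, Set.mem_ofPred_eq, ← initSeg_succ] at hup
        exact ⟨l + 1, Nat.succ_le_of_lt ((hk.trans (level_initSeg_mono p hl)).trans_lt hup)⟩
    obtain ⟨k, hk⟩ := hgrow (n + 1)
    exact cyl_subset_of_lt_level hk (by simp [cyl])

end Level

/-- A countably infinite set is in bijection with `ℕ × ℕ`; the first coordinate indexes the infinite
classes. -/
theorem exists_separates_good_eq {G : List ℕ → Set ℕ} (hG : ∀ z, (G z).Infinite) :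
    ∃ e, TrackState.Separates e ∧ TrackState.good e = G := by
  have h : ∀ z, Nonempty (ℕ × ℕ ≃ G z) := fun z => by
    have := (hG z).to_subtype
    exact nonempty_equiv_of_countable
  let f := fun z => (h z).some
  refine ⟨fun z i j => (f z (i, j) : ℕ), fun z i j i' j' hij => ?_, ?_⟩
  · simpa using (f z).injective (Subtype.ext hij)
  · ext z m
    constructor
    · rintro ⟨i, j, rfl⟩
      exact (f z (i, j)).2
    · intro hm
      exact ⟨((f z).symm ⟨m, hm⟩).1, ((f z).symm ⟨m, hm⟩).2, by simp⟩

theorem mainTheorem2 (U : ℕ → Set (ℕ → ℕ))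
    (hU_open : ∀ n, IsOpen (U n))
    (hU_dense : ∀ n, IsPiDense (U n))
    (Y : Set (ℕ → ℕ)) (hY : Y = ⋂ n, U n) :
    ∃ H : FoliageTree.{0, 0} Y,
      ∀ τ : TopologicalSpace (ℕ → ℕ), FoliageTree.standard.IsPiTreeOn τ →
        H.IsPiTreeOn (TopologicalSpace.induced (Subtype.val : Y → (ℕ → ℕ)) τ) := by
  obtain ⟨e, he, hG⟩ := exists_separates_good_eq (infinite_levelUp hU_dense)
  have hY' : ∀ p, p ∈ Y ↔ GoodInfinitelyOften (TrackState.good e) p := fun p => by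
    rw [hY, hG]
    exact mem_iInter_iff_goodInfinitelyOften hU_open p
  exact ⟨TrackState.foliage e Y, fun τ hτ => ⟨TrackState.isBaireOn_foliage he hY' hτ.1.isOpenIn,
    TrackState.growsInto_foliage he hY' hτ.2⟩⟩
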